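/- Let $R$ be a commutative ring with unit containing $\mathbb{Q}$, let $n\ge 0$, and let $F=(F_i)_{1\le i\le n}$ be a system of $n$ formal power series $F_i\in R[[X_1,\ldots,X_n]]$ without constant term. Let $A=(A_{ij})$, $A_{ij}=\left.\frac{\partial F_i}{\partial X_j}\right|_{X=0}$, be the matrix of the linear part $L_i(X)=\sum_j A_{ij}X_j$, assume that $A\in GL_n(R)$, and write $F_i=L_i-H_i$, where $-H_i$ is the sum of the terms of $F_i$ of total degree at least $2$. Let $\overline u=(\overline u_1,\ldots,\overline u_n)$, $u=(u_1,\ldots,u_n)$, $Y=(Y_1,\ldots,Y_n)$ be vectors of indeterminates, and write $\overline u H(u)=\sum_i \overline u_i H_i(u)$, $\overline u Y=\sum_i\overline u_iY_i$. For multiindices $\alpha_1,\alpha_2\in\mathbb{N}^n$ define $$\int d\overline u\,du\; e^{-\overline uAu}\;\overline u^{\alpha_1}u^{\alpha_2}:=(\det A)^{-1}\sum_{\sigma}\prod_{k=1}^{|\alpha_1|}\left[A^{-1}\right]_{\tau_2(\sigma(k))\,\tau_1(k)}\in R,$$ where $\tau_1:\{1,\ldots,|\alpha_1|\}\to\{1,\ldots,n\}$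 and $\tau_2:\{1,\ldots,|\alpha_2|\}\to\{1,\ldots,n\}$ are any maps that take each value $i$ exactly $(\alpha_1)_i$, respectively $(\alpha_2)_i$, times, and $\sigma$ runs over all bijections $\{1,\ldots,|\alpha_1|\}\to\{1,\ldots,|\alpha_2|\}$ (so the value is $0$ if $|\alpha_1|\ne|\alpha_2|$). For $U=\sum c_{\alpha_1,\alpha_2,\alpha_3}\overline u^{\alpha_1}u^{\alpha_2}Y^{\alpha_3}\in R[[\overline u,u,Y]]$ the formal Gaussian integral is $$\int d\overline u\,du\; e^{-\overline uAu}\;U:=\sum_{\alpha_1,\alpha_2,\alpha_3}c_{\alpha_1,\alpha_2,\alpha_3}\,Y^{\alpha_3}\int d\overline u\,du\; e^{-\overline uAu}\;\overline u^{\alpha_1}u^{\alpha_2}\in R[[Y]],$$ provided that this is summable in $R[[Y]]$, i.e. that for each $\alpha_3$ only finitely many $(\alpha_1,\alpha_2)$ give a nonzero contribution. Then the formal Gaussian integrals of $e^{\overline uH(u)+\overline uY}$ and, for every $1\le i\le n$, of $u_ie^{\overline uH(u)+\overline uY}$ are summable in $R[[Y]]$; the former is invertible in $R[[Y]]$; the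 system $F$ has a unique compositional inverse $F^{-1}$ (a system of $n$ power series without constant term with $F(F^{-1}(Y))=Y$ and $F^{-1}(F(X))=X$); and for every $1\le i\le n$ $$(F^{-1})_i(Y)=\frac{\displaystyle\int d\overline u\,du\; e^{-\overline uAu}\;u_i\,e^{\overline uH(u)+\overline uY}}{\displaystyle\int d\overline u\,du\; e^{-\overline uAu}\;e^{\overline uH(u)+\overline uY}}\quad\text{in }R[[Y]].$$ -/

import Mathlib

noncomputable section

namespace FormalGauss

variable {R : Type*} [CommRing R] {n : ℕ}

/-- `G` is the compositional inverse of `F`: both systems have no constant term and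
`F(G(Y)) = Y`, `G(F(X)) = X`. -/
structure IsCompInverse (F G : Fin n → MvPowerSeries (Fin n) R) : Prop where
  constantCoeff_left : ∀ i, MvPowerSeries.constantCoeff (F i) = 0
  constantCoeff_right : ∀ i, MvPowerSeries.constantCoeff (G i) = 0
  comp_left : ∀ i, (F i).subst G = (MvPowerSeries.X i : MvPowerSeries (Fin n) R)
  comp_right : ∀ i, (G i).subst F = (MvPowerSeries.X i : MvPowerSeries (Fin n) R)

/-- The matrix `A` of the linear part of `F`: `A i j = ∂F_i/∂X_j` at `X = 0`. -/
def linMatrix (F : Fin n → MvPowerSeries (Fin n) R) : Matrix (Fin n) (Fin n) R :=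
  Matrix.of fun i j => MvPowerSeries.coeff (Finsupp.single j 1) (F i)

/-- The linear part `L_i(X) = ∑ j, A i j * X_j`. -/
def linPart (F : Fin n → MvPowerSeries (Fin n) R) (i : Fin n) : MvPowerSeries (Fin n) R :=
  ∑ j, MvPowerSeries.C (linMatrix F i j) * MvPowerSeries.X j

/-- The nonlinear part `H`: minus the sum of the terms of `F` of total degree at least two. -/
def nonlinPart (F : Fin n → MvPowerSeries (Fin n) R) (i : Fin n) : MvPowerSeries (Fin n) R :=
  fun d => if 2 ≤ d.degree then -MvPowerSeries.coeff d (F i) else 0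

/-- For `F` without constant term, `F = L - H`. -/
theorem eq_linPart_sub_nonlinPart (F : Fin n → MvPowerSeries (Fin n) R)
    (hF : ∀ i, MvPowerSeries.constantCoeff (F i) = 0) (i : Fin n) :
    F i = linPart F i - nonlinPart F i := by
  classical
  ext d
  have hlin : MvPowerSeries.coeff d (linPart F i) =
      ∑ j, if d = Finsupp.single j 1 then linMatrix F i j else 0 := by
    simp [linPart, MvPowerSeries.coeff_X]
  have hnon : MvPowerSeries.coeff d (nonlinPart F i) =
      if 2 ≤ d.degree then -MvPowerSeries.coeff d (F i) else 0 := rfl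
  rw [map_sub, hlin, hnon]
  by_cases h2 : 2 ≤ d.degree
  · rw [if_pos h2, Finset.sum_eq_zero]
    · simp
    · intro j _
      rw [if_neg]
      rintro rfl
      simp at h2
  · rw [if_neg h2, sub_zero]
    have h01 : d.degree = 0 ∨ d.degree = 1 := by omega
    rcases h01 with h | h
    · obtain rfl := (Finsupp.degree_eq_zero_iff d).1 h
      rw [Finset.sum_eq_zero]
      · simpa using hF i
      · intro j _
        rw [if_neg]
        intro hj
        simpa using DFunLike.congr_fun hj j
    · obtain ⟨j, rfl⟩ := (Finsupp.sum_eq_one_iff d).1 h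
      rw [Finset.sum_eq_single j]
      · simp [linMatrix]
      · intro k _ hk
        rw [if_neg]
        intro he
        exact hk ((Finsupp.single_left_injective one_ne_zero he).symm)
      · simp

/-- The indeterminates of `R[[ū, u, Y]]`, in this order. -/
abbrev Vars (n : ℕ) : Type := Fin n ⊕ Fin n ⊕ Fin n

/-- The indeterminate `ū_i` of `R[[ū, u, Y]]`. -/
def ubar (R : Type*) [CommRing R] {n : ℕ} (i : Fin n) : MvPowerSeries (Vars n) R :=
  MvPowerSeries.X (Sum.inl i)

/-- The indeterminate `u_i` of `R[[ū, u, Y]]`. -/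
def uvar (R : Type*) [CommRing R] {n : ℕ} (i : Fin n) : MvPowerSeries (Vars n) R :=
  MvPowerSeries.X (Sum.inr (Sum.inl i))

/-- The indeterminate `Y_i` of `R[[ū, u, Y]]`. -/
def yvar (R : Type*) [CommRing R] {n : ℕ} (i : Fin n) : MvPowerSeries (Vars n) R :=
  MvPowerSeries.X (Sum.inr (Sum.inr i))

/-- The interaction `ūH(u) + ūY = ∑ i, ū_i H_i(u) + ∑ i, ū_i Y_i`. -/
def interaction (F : Fin n → MvPowerSeries (Fin n) R) : MvPowerSeries (Vars n) R :=
  ∑ i, ubar R i * (nonlinPart F i).subst (uvar R : Fin n → MvPowerSeries (Vars n) R) +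
    ∑ i, ubar R i * yvar R i

/-- `exp (ūH(u) + ūY)` in `R[[ū, u, Y]]`. -/
def expInteraction [Algebra ℚ R] (F : Fin n → MvPowerSeries (Fin n) R) :
    MvPowerSeries (Vars n) R :=
  (PowerSeries.exp R).subst (interaction F)

/-- `I_A(τ₁, τ₂) = ∑ σ, ∏ k, A⁻¹ (τ₂ (σ k)) (τ₁ k)`, the sum being over all bijections `σ` between
the (finite) domains of `τ₁` and `τ₂`; it is zero if there are none. -/
def wickSum (A : Matrix (Fin n) (Fin n) R) {ι κ : Type*} [Fintype ι] [Fintype κ]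
    [DecidableEq ι] [DecidableEq κ] (τ₁ : ι → Fin n) (τ₂ : κ → Fin n) : R :=
  ∑ σ : ι ≃ κ, ∏ k, A⁻¹ (τ₂ (σ k)) (τ₁ k)

/-- The formal Gaussian integral of the monomial `ū^α₁ u^α₂` with covariance `A⁻¹`:
`(det A)⁻¹ * I_A(τ₁, τ₂)` for maps `τ₁`, `τ₂` with multiplicity multiindices `α₁`, `α₂`. The
canonical such maps are used here; `gaussMonomial_eq` shows that any others give the same. -/
def gaussMonomial (A : Matrix (Fin n) (Fin n) R) (α₁ α₂ : Fin n →₀ ℕ) : R :=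
  Ring.inverse A.det *
    wickSum A (fun p : (Σ i : Fin n, Fin (α₁ i)) => p.1) (fun p : (Σ i : Fin n, Fin (α₂ i)) => p.1)

/-- The value does not depend on the choice of `τ₁ : [k₁] → [n]` and `τ₂ : [k₂] → [n]`. -/
theorem gaussMonomial_eq (A : Matrix (Fin n) (Fin n) R) (α₁ α₂ : Fin n →₀ ℕ) {k₁ k₂ : ℕ}
    (τ₁ : Fin k₁ → Fin n) (τ₂ : Fin k₂ → Fin n)
    (h₁ : ∀ i, (Finset.univ.filter fun k => τ₁ k = i).card = α₁ i)
    (h₂ : ∀ i, (Finset.univ.filter fun k => τ₂ k = i).card = α₂ i) :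
    gaussMonomial A α₁ α₂ = Ring.inverse A.det * wickSum A τ₁ τ₂ := by
  classical
  have key : ∀ (α : Fin n →₀ ℕ) (k : ℕ) (τ : Fin k → Fin n),
      (∀ i, (Finset.univ.filter fun k => τ k = i).card = α i) →
      ∃ e : Fin k ≃ (Σ i : Fin n, Fin (α i)), ∀ x, (e x).1 = τ x := by
    intro α k τ h
    refine ⟨(Equiv.sigmaFiberEquiv τ).symm.trans (Equiv.sigmaCongrRight fun i =>
      Fintype.equivFinOfCardEq ((Fintype.card_subtype _).trans (h i))), fun x => rfl⟩
  obtain ⟨e₁, he₁⟩ := key α₁ k₁ τ₁ h₁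
  obtain ⟨e₂, he₂⟩ := key α₂ k₂ τ₂ h₂
  unfold gaussMonomial wickSum
  congr 1
  refine (Fintype.sum_equiv (Equiv.equivCongr e₁ e₂) _ _ fun σ => ?_).symm
  refine Fintype.prod_equiv e₁ _ _ fun k => ?_
  simp [he₁, he₂]

/-- The coefficient of `Y^α₃` in the contribution of the multiindices `(α₁, α₂)` to the formal
Gaussian integral of `U`. -/
def gaussTerm (A : Matrix (Fin n) (Fin n) R) (U : MvPowerSeries (Vars n) R)
    (α₃ : Fin n →₀ ℕ) (α : (Fin n →₀ ℕ) × (Fin n →₀ ℕ)) : R :=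
  MvPowerSeries.coeff (Finsupp.sumElim α.1 (Finsupp.sumElim α.2 α₃)) U * gaussMonomial A α.1 α.2

/-- Summability in `R[[Y]]` of the formal Gaussian integral of `U`: for every `α₃`, only finitely
many `(α₁, α₂)` give a nonzero contribution. -/
def GaussSummable (A : Matrix (Fin n) (Fin n) R) (U : MvPowerSeries (Vars n) R) : Prop :=
  ∀ α₃ : Fin n →₀ ℕ, {α | gaussTerm A U α₃ α ≠ 0}.Finite

/-- The formal Gaussian integral `∫ dū du e^{-ūAu} U`, an element of `R[[Y]]`
(meaningful if `GaussSummable A U`). -/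
def gaussIntegral (A : Matrix (Fin n) (Fin n) R) (U : MvPowerSeries (Vars n) R) :
    MvPowerSeries (Fin n) R :=
  fun α₃ => ∑ᶠ α, gaussTerm A U α₃ α

end FormalGauss

end

/-!
Write `⟨Q⟩` for the formal Gaussian integral of `Q(u) e^{ūH(u) + ūY}`. Wick's formula is compatible
with integration by parts, which in the variable `ū_j` gives the Schwinger–Dyson equation
`⟨F_j Q⟩ = Y_j ⟨Q⟩`. Hence `⟨Q ∘ F⟩ = Q ⟨1⟩`, first for polynomials and then, by continuity, for
all power series `Q`. Since `⟨1⟩` has constant term `(det A)⁻¹`, the map `Q ↦ ⟨Q⟩ / ⟨1⟩` is thus a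
left inverse of composition with `F`. It does not decrease the order, so it is a surjective
endomorphism of each finite `R`-module `R[[X]] / (order ≥ k)`, hence injective there, and therefore
a two-sided inverse. In particular `F⁻¹_i = ⟨u_i⟩ / ⟨1⟩`.
-/

namespace FormalGauss

open MvPowerSeries

section Order

variable {R : Type*} [CommRing R] {σ τ : Type*}

/-- The module of power series of order at least `k`, a neighbourhood of zero that a
continuity argument can divide out. -/
noncomputable def orderGE (R σ : Type*) [CommRing R] (k : ℕ) : Submodule R (MvPowerSeries σ R) :=
  LinearMap.ker (LinearMap.pi fun d : {d : σ →₀ ℕ // d.degree < k} => coeff (R := R) d.1)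

theorem mem_orderGE {k : ℕ} {Q : MvPowerSeries σ R} : Q ∈ orderGE R σ k ↔ (k : ℕ∞) ≤ Q.order := by
  rw [orderGE, LinearMap.mem_ker, funext_iff]
  exact ⟨fun h => nat_le_order fun d hd => h ⟨d, hd⟩,
    fun h d => coeff_of_lt_order ((Nat.cast_lt.2 d.2).trans_le h)⟩

instance [Finite σ] (k : ℕ) : Module.Finite R (MvPowerSeries σ R ⧸ orderGE R σ k) := by
  classical
  have : Finite {d : σ →₀ ℕ // d.degree < k} := Finsupp.finite_of_degree_lt k
  refine Module.Finite.equiv (LinearMap.quotKerEquivOfSurjective _ fun c => ?_).symm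
  exact ⟨fun d => if h : d.degree < k then c ⟨d, h⟩ else 0, funext fun d => dif_pos d.2⟩

theorem eq_zero_of_forall_mem_orderGE {Q : MvPowerSeries σ R} (h : ∀ k, Q ∈ orderGE R σ k) :
    Q = 0 :=
  order_eq_top_iff.1 (ENat.eq_top_iff_forall_ge.2 fun k => mem_orderGE.1 (h k))

theorem sub_truncTotal_mem_orderGE [Finite σ] (k : ℕ) (Q : MvPowerSeries σ R) :
    Q - (truncTotal k Q : MvPowerSeries σ R) ∈ orderGE R σ k :=
  mem_orderGE.2 <| nat_le_order fun d hd => by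
    rw [map_sub, MvPolynomial.coeff_coe, coeff_truncTotal _ hd, sub_self]

theorem linearMap_eq_of_eq_on_mvPolynomial [Finite σ]
    {f g : MvPowerSeries σ R →ₗ[R] MvPowerSeries τ R}
    (hf : ∀ Q, Q.order ≤ (f Q).order) (hg : ∀ Q, Q.order ≤ (g Q).order)
    (h : ∀ p : MvPolynomial σ R, f p = g p) : f = g := by
  refine LinearMap.ext fun Q => sub_eq_zero.1 (eq_zero_of_forall_mem_orderGE fun k => ?_)
  have hQ := mem_orderGE.1 (sub_truncTotal_mem_orderGE k Q)
  have hfg : f Q - g Q = f (Q - (truncTotal k Q : MvPowerSeries σ R)) -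
      g (Q - (truncTotal k Q : MvPowerSeries σ R)) := by
    rw [map_sub, map_sub, h, sub_sub_sub_cancel_right]
  rw [hfg]
  exact sub_mem (mem_orderGE.2 (hQ.trans (hf _))) (mem_orderGE.2 (hQ.trans (hg _)))

/-- Modulo each `orderGE R σ k` this is Orzech's theorem for a finite module. -/
theorem injective_of_surjective_of_le_order [Finite σ]
    {f : MvPowerSeries σ R →ₗ[R] MvPowerSeries σ R} (hf : ∀ Q, Q.order ≤ (f Q).order)
    (hsurj : Function.Surjective f) : Function.Injective f := by
  refine (injective_iff_map_eq_zero f).2 fun Q hQ => eq_zero_of_forall_mem_orderGE fun k => ?_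
  have hk : orderGE R σ k ≤ (orderGE R σ k).comap f := fun P hP =>
    mem_orderGE.2 ((mem_orderGE.1 hP).trans (hf P))
  have hinj := OrzechProperty.injective_of_surjective_endomorphism
    ((orderGE R σ k).mapQ (orderGE R σ k) f hk) (by
      rintro ⟨P⟩
      obtain ⟨P', rfl⟩ := hsurj P
      exact ⟨Submodule.Quotient.mk P', rfl⟩)
  rw [← Submodule.Quotient.mk_eq_zero]
  refine hinj ?_
  rw [Submodule.mapQ_apply, hQ, Submodule.Quotient.mk_zero, map_zero]

theorem order_le_order_subst {a : σ → MvPowerSeries τ R} [Finite σ]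
    (ha : ∀ i, constantCoeff (a i) = 0) (Q : MvPowerSeries σ R) : Q.order ≤ (Q.subst a).order :=
  (le_mul_of_one_le_left' <| le_iInf fun i => one_le_order_iff_constCoeff_eq_zero.2 (ha i)).trans
    (le_order_subst (hasSubst_of_constantCoeff_zero ha) Q)

end Order

section ChainRule

variable {R : Type*} [CommSemiring R] {σ τ : Type*}

theorem coeff_add_single_X_mul (i : σ) (d : σ →₀ ℕ) (f : MvPowerSeries σ R) :
    coeff (d + Finsupp.single i 1) (X i * f) = coeff d f := by
  rw [X, add_comm, coeff_add_monomial_mul, one_mul]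

theorem coeff_X_mul_eq_zero {i : σ} {d : σ →₀ ℕ} (h : d i = 0)
    (f : MvPowerSeries σ R) : coeff d (X i * f) = 0 := by
  classical
  rw [X, coeff_monomial_mul, if_neg]
  simp [Finsupp.single_le_iff, h]

theorem pderiv_rename_eq_zero {e : τ → σ} [Filter.TendstoCofinite e] {i : σ}
    (hi : i ∉ Set.range e) (Q : MvPowerSeries τ R) : pderiv R i (Q.rename e) = 0 := by
  ext d
  rw [coeff_pderiv, coeff_rename_eq_zero, zero_mul, map_zero]
  rintro ⟨c, hc⟩
  have := DFunLike.congr_fun hc i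
  rw [Finsupp.mapDomain_of_notMem_range _ _ hi] at this
  simp at this

/-- Writing `f = X * g + c`, the defect of the chain rule for `f` is `a` times the defect for `g`,
so it has arbitrarily large order. -/
theorem pderiv_powerSeries_subst {R : Type*} [CommRing R] (f : PowerSeries R)
    {a : MvPowerSeries σ R} (ha : constantCoeff a = 0) (i : σ) :
    pderiv R i (f.subst a) = (PowerSeries.derivative R f).subst a * pderiv R i a := by
  have hs : PowerSeries.HasSubst a := .of_constantCoeff_zero ha
  refine sub_eq_zero.1 (eq_zero_of_forall_mem_orderGE fun k => ?_)
  induction k generalizing f with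
  | zero => simp [mem_orderGE]
  | succ k ih =>
    obtain ⟨g, c, rfl⟩ : ∃ g c, f = PowerSeries.X * g + PowerSeries.C c :=
      ⟨_, _, f.eq_X_mul_shift_add_const⟩
    have hdefect : pderiv R i ((PowerSeries.X * g + PowerSeries.C c).subst a) -
        (PowerSeries.derivative R (PowerSeries.X * g + PowerSeries.C c)).subst a * pderiv R i a =
        a * (pderiv R i (g.subst a) - (PowerSeries.derivative R g).subst a * pderiv R i a) := by
      simp only [PowerSeries.subst_add hs, PowerSeries.subst_mul hs, PowerSeries.subst_X hs,
        PowerSeries.subst_C, map_add, Derivation.leibniz, smul_eq_mul,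
        PowerSeries.derivative_X, PowerSeries.derivative_C, pderiv_C, mul_one, add_zero]
      ring
    rw [hdefect, mem_orderGE, Nat.cast_succ, add_comm]
    exact (add_le_add (one_le_order_iff_constCoeff_eq_zero.2 ha) (mem_orderGE.1 (ih g))).trans
      le_order_mul

end ChainRule

section Weight

variable {R M σ τ : Type*} [CommSemiring R] [AddCommMonoid M] [PartialOrder M]
  {w : σ → M} {k l : M} {U V : MvPowerSeries σ R}

/-- The module of power series all of whose monomials have weight at least `k`; unlike in
`MvPowerSeries.weightedOrder`, weights may be negative. -/
def weightGE (R : Type*) [CommSemiring R] (w : σ → M) (k : M) :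
    Submodule R (MvPowerSeries σ R) where
  carrier := {U | ∀ d, coeff d U ≠ 0 → k ≤ Finsupp.weight w d}
  zero_mem' d hd := absurd (coeff_zero d) hd
  add_mem' {U V} hU hV d hd := by
    by_cases h : coeff d U = 0
    · exact hV d (by rwa [map_add, h, zero_add] at hd)
    · exact hU d h
  smul_mem' r U hU d hd := hU d (right_ne_zero_of_mul (by rwa [coeff_smul] at hd))

theorem weightGE_antitone (w : σ → M) : Antitone (weightGE R w) :=
  fun _ _ hkl _ hU d hd => hkl.trans (hU d hd)

theorem monomial_mem_weightGE (d : σ →₀ ℕ) (r : R) :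
    monomial d r ∈ weightGE R w (Finsupp.weight w d) := by
  classical
  intro e he
  rw [coeff_monomial] at he
  rw [(ite_ne_right_iff.1 he).1]

theorem X_mem_weightGE (w : σ → M) (i : σ) : (X i : MvPowerSeries σ R) ∈ weightGE R w (w i) := by
  simpa [X, Finsupp.weight_single] using monomial_mem_weightGE (w := w) (Finsupp.single i 1) (1 : R)

theorem rename_mem_weightGE {e : τ → σ} [Filter.TendstoCofinite e] {Q : MvPowerSeries τ R}
    (hQ : Q ∈ weightGE R (w ∘ e) k) : Q.rename e ∈ weightGE R w k := by
  classical
  intro d hd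
  rw [coeff_rename] at hd
  obtain ⟨c, hc, hne⟩ := Finset.exists_ne_zero_of_sum_ne_zero hd
  rw [Set.Finite.mem_toFinset] at hc
  obtain rfl : Finsupp.mapDomain e c = d := hc
  simpa [Finsupp.weight_apply, Finsupp.sum_mapDomain_index, add_smul] using hQ c hne

variable [IsOrderedAddMonoid M]

theorem mul_mem_weightGE (hU : U ∈ weightGE R w k) (hV : V ∈ weightGE R w l) :
    U * V ∈ weightGE R w (k + l) := by
  classical
  intro d hd
  rw [coeff_mul] at hd
  obtain ⟨x, hx, hne⟩ := Finset.exists_ne_zero_of_sum_ne_zero hd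
  rw [← Finset.HasAntidiagonal.mem_antidiagonal.1 hx, map_add]
  exact add_le_add (hU _ (left_ne_zero_of_mul hne)) (hV _ (right_ne_zero_of_mul hne))

theorem pow_mem_weightGE_zero (hU : U ∈ weightGE R w 0) (m : ℕ) : U ^ m ∈ weightGE R w 0 := by
  induction m with
  | zero => simpa using monomial_mem_weightGE (w := w) 0 (1 : R)
  | succ m ih => simpa [pow_succ] using mul_mem_weightGE ih hU

theorem powerSeries_subst_mem_weightGE_zero {R : Type*} [CommRing R] {U : MvPowerSeries σ R}
    (hU : U ∈ weightGE R w 0) (hc : constantCoeff U = 0) (f : PowerSeries R) :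
    f.subst U ∈ weightGE R w 0 := by
  intro d hd
  rw [PowerSeries.coeff_subst (.of_constantCoeff_zero hc)] at hd
  obtain ⟨m, hm⟩ := not_forall.1 (mt finsum_eq_zero_of_forall_eq_zero hd)
  exact pow_mem_weightGE_zero hU m d (right_ne_zero_of_smul hm)

end Weight

section CardFiber

variable {n : ℕ} {ι κ β : Type*} [Fintype ι] [Fintype κ] [DecidableEq β]

theorem card_filter_comp_equiv {ι' : Type*} [Fintype ι']
    (τ : ι → β) (e : ι' ≃ ι) (i : β) :
    (Finset.univ.filter fun k => (τ ∘ e) k = i).card =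
      (Finset.univ.filter fun k => τ k = i).card :=
  Finset.card_equiv e (by simp)

theorem card_filter_sigma_fst (α : Fin n →₀ ℕ) (i : Fin n) :
    (Finset.univ.filter fun p : (Σ i : Fin n, Fin (α i)) => p.1 = i).card = α i := by
  rw [← Fintype.card_subtype, Fintype.card_congr (Equiv.sigmaSubtype i), Fintype.card_fin]

theorem card_filter_option_elim (τ : κ → β) (k i : β) :
    (Finset.univ.filter fun o : Option κ => o.elim k τ = i).card =
      (Finset.univ.filter fun x => τ x = i).card + Finsupp.single k 1 i := by
  rw [Finset.card_filter, Finset.card_filter, Fintype.sum_option, Finsupp.single_apply, add_comm]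
  rfl

theorem card_filter_ne [DecidableEq ι] (τ : ι → β) (p : ι) (i : β) :
    (Finset.univ.filter fun x : {x // x ≠ p} => τ x = i).card =
      (Finset.univ.filter fun x => τ x = i).card - Finsupp.single (τ p) 1 i := by
  rw [Finset.card_filter, Finset.card_filter, ← Finset.add_sum_erase _ _ (Finset.mem_univ p),
    ← Finset.sum_subtype (Finset.univ.erase p) (by simp) fun x => if τ x = i then 1 else 0,
    Finsupp.single_apply, add_tsub_cancel_left]

end CardFiber

section Wick

variable {R : Type*} [CommRing R] {n : ℕ} {A : Matrix (Fin n) (Fin n) R}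
  {ι κ : Type*} [Fintype ι] [Fintype κ] [DecidableEq ι] [DecidableEq κ]

theorem wickSum_comp_equiv {ι' κ' : Type*} [Fintype ι'] [Fintype κ'] [DecidableEq ι']
    [DecidableEq κ'] (τ₁ : ι → Fin n) (τ₂ : κ → Fin n) (e₁ : ι' ≃ ι) (e₂ : κ' ≃ κ) :
    wickSum A (τ₁ ∘ e₁) (τ₂ ∘ e₂) = wickSum A τ₁ τ₂ :=
  Fintype.sum_equiv (Equiv.equivCongr e₁ e₂) _ _ fun σ =>
    Fintype.prod_equiv e₁ _ _ fun k => by simp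

theorem wickSum_eq_sum_symm (τ₁ : ι → Fin n) (τ₂ : κ → Fin n) :
    wickSum A τ₁ τ₂ = ∑ σ : κ ≃ ι, ∏ k, A⁻¹ (τ₂ k) (τ₁ (σ k)) :=
  Fintype.sum_equiv (Equiv.symmEquiv ι κ) _ _ fun σ =>
    Fintype.prod_equiv σ _ _ fun k => by simp

theorem wickSum_option (τ₁ : ι → Fin n) (τ₂ : Option κ → Fin n) :
    wickSum A τ₁ τ₂ = ∑ p, A⁻¹ (τ₂ none) (τ₁ p) *
      wickSum A (fun x : {x // x ≠ p} => τ₁ x) (fun x => τ₂ (some x)) := by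
  rw [wickSum_eq_sum_symm,
    ← Finset.sum_fiberwise Finset.univ (fun σ : Option κ ≃ ι => σ none)]
  refine Finset.sum_congr rfl fun p _ => ?_
  rw [wickSum_eq_sum_symm, Finset.mul_sum,
    Finset.sum_subtype (p := fun σ : Option κ ≃ ι => σ none = p) _ (by simp)]
  refine Fintype.sum_equiv (Equiv.optionSubtype p) _ _ fun σ => ?_
  rw [Fintype.prod_option, σ.2]
  rfl

/-- The factor `A` cancels the propagator `A⁻¹` of the distinguished `u`. -/
theorem sum_mul_wickSum_option (hA : IsUnit A) (j : Fin n) (τ₁ : ι → Fin n) (τ₂ : κ → Fin n) :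
    ∑ k, A j k * wickSum A τ₁ (fun o : Option κ => o.elim k τ₂) =
      ∑ p with τ₁ p = j, wickSum A (fun x : {x // x ≠ p} => τ₁ x) τ₂ := by
  have hAA : ∀ i, ∑ k, A j k * A⁻¹ k i = if i = j then 1 else 0 := fun i => by
    rw [← Matrix.mul_apply, Matrix.mul_nonsing_inv _ ((Matrix.isUnit_iff_isUnit_det _).1 hA),
      Matrix.one_apply]
    simp only [eq_comm]
  simp only [wickSum_option, Option.elim_none, Option.elim_some, Finset.mul_sum, ← mul_assoc]
  rw [Finset.sum_comm, Finset.sum_filter]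
  simp only [← Finset.sum_mul, hAA, ite_mul, one_mul, zero_mul]

theorem gaussMonomial_eq_wickSum {α₁ α₂ : Fin n →₀ ℕ} (τ₁ : ι → Fin n) (τ₂ : κ → Fin n)
    (h₁ : ∀ i, (Finset.univ.filter fun k => τ₁ k = i).card = α₁ i)
    (h₂ : ∀ i, (Finset.univ.filter fun k => τ₂ k = i).card = α₂ i) :
    gaussMonomial A α₁ α₂ = Ring.inverse A.det * wickSum A τ₁ τ₂ := by
  rw [gaussMonomial_eq A α₁ α₂ (τ₁ ∘ (Fintype.equivFin ι).symm) (τ₂ ∘ (Fintype.equivFin κ).symm)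
    (fun i => (card_filter_comp_equiv τ₁ _ i).trans (h₁ i))
    (fun i => (card_filter_comp_equiv τ₂ _ i).trans (h₂ i)), wickSum_comp_equiv]

theorem gaussMonomial_zero_zero : gaussMonomial A 0 0 = Ring.inverse A.det := by
  rw [gaussMonomial_eq_wickSum Empty.elim Empty.elim (by simp) (by simp)]
  simp [wickSum]

theorem gaussMonomial_eq_zero {α₁ α₂ : Fin n →₀ ℕ} (h : α₁.degree ≠ α₂.degree) :
    gaussMonomial A α₁ α₂ = 0 := by
  have : IsEmpty ((Σ i : Fin n, Fin (α₁ i)) ≃ (Σ i : Fin n, Fin (α₂ i))) := by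
    refine ⟨fun e => h ?_⟩
    simpa [Finsupp.degree_eq_sum] using Fintype.card_congr e
  simp [gaussMonomial, wickSum]

theorem sum_mul_gaussMonomial (hA : IsUnit A) (j : Fin n) (α₁ α₂ : Fin n →₀ ℕ) :
    ∑ k, A j k * gaussMonomial A α₁ (α₂ + Finsupp.single k 1) =
      α₁ j * gaussMonomial A (α₁ - Finsupp.single j 1) α₂ := by
  let τ₁ : (Σ i : Fin n, Fin (α₁ i)) → Fin n := fun p => p.1
  let τ₂ : (Σ i : Fin n, Fin (α₂ i)) → Fin n := fun p => p.1
  have hadd : ∀ k, gaussMonomial A α₁ (α₂ + Finsupp.single k 1) =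
      Ring.inverse A.det * wickSum A τ₁ (fun o : Option _ => o.elim k τ₂) := fun k =>
    gaussMonomial_eq_wickSum _ _ (card_filter_sigma_fst α₁) fun i => by
      rw [card_filter_option_elim, card_filter_sigma_fst, Finsupp.add_apply]
  have hsub : ∀ p, τ₁ p = j → gaussMonomial A (α₁ - Finsupp.single j 1) α₂ =
      Ring.inverse A.det * wickSum A (fun x : {x // x ≠ p} => τ₁ x) τ₂ := by
    rintro p rfl
    refine gaussMonomial_eq_wickSum _ _ (fun i => ?_) (card_filter_sigma_fst α₂)
    rw [card_filter_ne, card_filter_sigma_fst, Finsupp.tsub_apply]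
  calc ∑ k, A j k * gaussMonomial A α₁ (α₂ + Finsupp.single k 1)
      = Ring.inverse A.det * ∑ p with τ₁ p = j, wickSum A (fun x : {x // x ≠ p} => τ₁ x) τ₂ := by
        simp only [hadd, mul_left_comm (A j _), ← Finset.mul_sum, sum_mul_wickSum_option hA]
    _ = ∑ p with τ₁ p = j, gaussMonomial A (α₁ - Finsupp.single j 1) α₂ := by
        rw [Finset.mul_sum]
        exact Finset.sum_congr rfl fun p hp => (hsub p (Finset.mem_filter.1 hp).2).symm
    _ = α₁ j * gaussMonomial A (α₁ - Finsupp.single j 1) α₂ := by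
        rw [Finset.sum_const, card_filter_sigma_fst, nsmul_eq_mul]

end Wick

section Integral

variable {R : Type*} [CommRing R] {n : ℕ} {A : Matrix (Fin n) (Fin n) R}
  {U V : MvPowerSeries (Vars n) R}

/-- The multiindex of the monomial `ū^α₁ u^α₂ Y^α₃`. -/
def varsExponent (α₁ α₂ α₃ : Fin n →₀ ℕ) : Vars n →₀ ℕ :=
  Finsupp.sumElim α₁ (Finsupp.sumElim α₂ α₃)

theorem varsExponent_add_single_ubar (α₁ α₂ α₃ : Fin n →₀ ℕ) (i : Fin n) :
    varsExponent (α₁ + Finsupp.single i 1) α₂ α₃ =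
      varsExponent α₁ α₂ α₃ + Finsupp.single (Sum.inl i) 1 := by
  ext (k | k | k) <;> simp [varsExponent, Finsupp.single_apply]

theorem varsExponent_add_single_uvar (α₁ α₂ α₃ : Fin n →₀ ℕ) (i : Fin n) :
    varsExponent α₁ (α₂ + Finsupp.single i 1) α₃ =
      varsExponent α₁ α₂ α₃ + Finsupp.single (Sum.inr (Sum.inl i)) 1 := by
  ext (k | k | k) <;> simp [varsExponent, Finsupp.single_apply]

theorem varsExponent_add_single_yvar (α₁ α₂ α₃ : Fin n →₀ ℕ) (i : Fin n) :
    varsExponent α₁ α₂ (α₃ + Finsupp.single i 1) =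
      varsExponent α₁ α₂ α₃ + Finsupp.single (Sum.inr (Sum.inr i)) 1 := by
  ext (k | k | k) <;> simp [varsExponent, Finsupp.single_apply]

theorem gaussTerm_eq (α₃ : Fin n →₀ ℕ) (α : (Fin n →₀ ℕ) × (Fin n →₀ ℕ)) :
    gaussTerm A U α₃ α = coeff (varsExponent α.1 α.2 α₃) U * gaussMonomial A α.1 α.2 :=
  rfl

theorem coeff_gaussIntegral (α₃ : Fin n →₀ ℕ) :
    coeff α₃ (gaussIntegral A U) = ∑ᶠ α, gaussTerm A U α₃ α :=
  rfl

theorem gaussIntegral_add (hU : GaussSummable A U) (hV : GaussSummable A V) :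
    gaussIntegral A (U + V) = gaussIntegral A U + gaussIntegral A V := by
  ext α₃
  simp only [map_add, coeff_gaussIntegral, gaussTerm_eq, add_mul]
  exact finsum_add_distrib (hU α₃) (hV α₃)

theorem gaussIntegral_smul (hU : GaussSummable A U) (r : R) :
    gaussIntegral A (r • U) = r • gaussIntegral A U := by
  ext α₃
  simp only [coeff_smul, coeff_gaussIntegral, gaussTerm_eq, mul_assoc]
  exact (mul_finsum' _ _ (hU α₃)).symm

theorem exists_eq_add_single {σ : Type*} {d : σ →₀ ℕ} {i : σ} (h : d i ≠ 0) :
    ∃ e, d = e + Finsupp.single i 1 :=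
  ⟨d - Finsupp.single i 1, (tsub_add_cancel_of_le (by
    simpa [Finsupp.single_le_iff, Nat.one_le_iff_ne_zero] using h)).symm⟩

theorem finsum_comp_of_support_subset_range {α β M : Type*} [AddCommMonoid M] {f : β → M}
    {g : α → β} (hg : Function.Injective g) (hs : Function.support f ⊆ Set.range g) :
    ∑ᶠ b, f b = ∑ᶠ a, f (g a) := by
  rw [← finsum_mem_range hg, ← finsum_mem_univ f]
  exact finsum_mem_inter_support_eq' _ _ _ fun b hb => by simpa using hs hb

theorem gaussIntegral_yvar_mul (j : Fin n) :
    gaussIntegral A (yvar R j * U) = X j * gaussIntegral A U := by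
  ext α₃
  by_cases h : α₃ j = 0
  · rw [coeff_X_mul_eq_zero h, coeff_gaussIntegral]
    refine finsum_eq_zero_of_forall_eq_zero fun α => ?_
    rw [gaussTerm, yvar, coeff_X_mul_eq_zero (by simpa using h), zero_mul]
  · obtain ⟨β, rfl⟩ := exists_eq_add_single h
    simp only [coeff_add_single_X_mul, coeff_gaussIntegral, gaussTerm_eq, yvar,
      varsExponent_add_single_yvar]

theorem gaussTerm_uvar_mul (k : Fin n) (α₃ α₁ α₂ : Fin n →₀ ℕ) :
    gaussTerm A (uvar R k * U) α₃ (α₁, α₂ + Finsupp.single k 1) =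
      coeff (varsExponent α₁ α₂ α₃) U * gaussMonomial A α₁ (α₂ + Finsupp.single k 1) := by
  rw [gaussTerm_eq, uvar, varsExponent_add_single_uvar, coeff_add_single_X_mul]

theorem coeff_gaussIntegral_uvar_mul (k : Fin n) (α₃ : Fin n →₀ ℕ) :
    coeff α₃ (gaussIntegral A (uvar R k * U)) =
      ∑ᶠ α : (Fin n →₀ ℕ) × (Fin n →₀ ℕ),
        coeff (varsExponent α.1 α.2 α₃) U * gaussMonomial A α.1 (α.2 + Finsupp.single k 1) := by
  simp only [← gaussTerm_uvar_mul]
  refine finsum_comp_of_support_subset_range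
    (g := fun α : (Fin n →₀ ℕ) × (Fin n →₀ ℕ) => (α.1, α.2 + Finsupp.single k 1))
    (fun a b h => by simpa [Prod.ext_iff] using h) ?_
  rintro ⟨α₁, α₂⟩ hα
  obtain ⟨β, rfl⟩ : ∃ β, α₂ = β + Finsupp.single k 1 := exists_eq_add_single fun h => hα (by
    rw [gaussTerm, uvar, coeff_X_mul_eq_zero (by simpa using h), zero_mul])
  exact ⟨(α₁, β), rfl⟩

theorem coeff_gaussIntegral_pderiv (j : Fin n) (α₃ : Fin n →₀ ℕ) :
    coeff α₃ (gaussIntegral A (pderiv R (Sum.inl j) U)) =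
      ∑ᶠ α : (Fin n →₀ ℕ) × (Fin n →₀ ℕ), coeff (varsExponent α.1 α.2 α₃) U *
        (α.1 j * gaussMonomial A (α.1 - Finsupp.single j 1) α.2) := by
  rw [finsum_comp_of_support_subset_range
    (g := fun α : (Fin n →₀ ℕ) × (Fin n →₀ ℕ) => (α.1 + Finsupp.single j 1, α.2))
    (fun a b h => by simpa [Prod.ext_iff] using h)]
  · refine finsum_congr fun α => ?_
    rw [gaussTerm_eq, coeff_pderiv, varsExponent_add_single_ubar]
    simp [varsExponent, mul_assoc]
  · rintro ⟨α₁, α₂⟩ hα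
    obtain ⟨β, rfl⟩ : ∃ β, α₁ = β + Finsupp.single j 1 :=
      exists_eq_add_single fun h => hα (by simp [h])
    exact ⟨(β, α₂), rfl⟩

theorem gaussIntegral_pderiv (hA : IsUnit A) (j : Fin n)
    (hU : ∀ k, GaussSummable A (uvar R k * U)) :
    gaussIntegral A (pderiv R (Sum.inl j) U) =
      ∑ k, A j k • gaussIntegral A (uvar R k * U) := by
  ext α₃
  have hfin : ∀ k, (Function.support fun α : (Fin n →₀ ℕ) × (Fin n →₀ ℕ) =>
      coeff (varsExponent α.1 α.2 α₃) U *
        gaussMonomial A α.1 (α.2 + Finsupp.single k 1)).Finite := fun k => by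
    simp only [← gaussTerm_uvar_mul]
    exact (hU k α₃).preimage fun a _ b _ h => by simpa [Prod.ext_iff] using h
  simp only [map_sum, coeff_smul, coeff_gaussIntegral_uvar_mul, coeff_gaussIntegral_pderiv,
    mul_finsum' _ _ (hfin _)]
  rw [← finsum_sum_comm _ _ fun k _ => (hfin k).subset fun α h hc => h (by simp [hc])]
  refine finsum_congr fun α => ?_
  rw [← sum_mul_gaussMonomial hA, Finset.mul_sum]
  exact Finset.sum_congr rfl fun k _ => mul_left_comm _ _ _

end Integral

section GaussWeight

variable {R : Type*} [CommRing R] {n : ℕ} {A : Matrix (Fin n) (Fin n) R}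
  {U : MvPowerSeries (Vars n) R} {Q : MvPowerSeries (Fin n) R} {c k : ℤ} {m : ℕ}

/-- Weights of `ū`, `u`, `Y` for which `ūH(u) + ūY` has weight at least zero when `c ≤ 1`. The
weights for `c = 1` bound the degrees of the contributing monomials, those for `c = 0` give a
sharp bound on the order of the integral. -/
def gaussWeight (n : ℕ) (c : ℤ) : Vars n → ℤ :=
  Sum.elim (fun _ => -(1 + c)) (Sum.elim (fun _ => 1) fun _ => 1 + c)

theorem weight_varsExponent (c : ℤ) (α₁ α₂ α₃ : Fin n →₀ ℕ) :
    Finsupp.weight (gaussWeight n c) (varsExponent α₁ α₂ α₃) =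
      (1 + c) * (α₃.degree - α₁.degree) + α₂.degree := by
  rw [Finsupp.weight_apply, Finsupp.sum_fintype _ _ (by simp)]
  simp [gaussWeight, varsExponent, Finsupp.degree_eq_sum, ← Finset.sum_mul]
  ring

theorem degree_of_gaussTerm_ne_zero (hU : U ∈ weightGE R (gaussWeight n c) k)
    {α₃ : Fin n →₀ ℕ} {α : (Fin n →₀ ℕ) × (Fin n →₀ ℕ)} (h : gaussTerm A U α₃ α ≠ 0) :
    α.1.degree = α.2.degree ∧ k + c * α.1.degree ≤ (1 + c) * α₃.degree := by
  have hdeg : α.1.degree = α.2.degree := by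
    by_contra hne
    exact h (by rw [gaussTerm, gaussMonomial_eq_zero hne, mul_zero])
  have hweight := hU _ (left_ne_zero_of_mul h)
  rw [← varsExponent, weight_varsExponent, ← hdeg] at hweight
  exact ⟨hdeg, by linarith⟩

theorem gaussSummable_of_mem_weightGE (hU : U ∈ weightGE R (gaussWeight n 1) k) :
    GaussSummable A U := by
  intro α₃
  have hfin := Finsupp.finite_of_degree_le (σ := Fin n) (2 * α₃.degree - k).toNat
  refine (hfin.prod hfin).subset fun α hα => ?_
  obtain ⟨hdeg, hle⟩ := degree_of_gaussTerm_ne_zero hU hα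
  simp only [Set.mem_prod, Set.mem_ofPred_eq]
  omega

theorem le_order_gaussIntegral (hU : U ∈ weightGE R (gaussWeight n 0) m) :
    (m : ℕ∞) ≤ (gaussIntegral A U).order := by
  refine nat_le_order fun α₃ hα₃ => finsum_eq_zero_of_forall_eq_zero fun α => ?_
  by_contra hα
  have := (degree_of_gaussTerm_ne_zero hU hα).2
  omega

theorem subst_uvar_eq_rename (Q : MvPowerSeries (Fin n) R) :
    Q.subst (uvar R : Fin n → MvPowerSeries (Vars n) R) = Q.rename (Sum.inr ∘ Sum.inl) :=
  (rename_eq_subst _ Q).symm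

theorem subst_uvar_mem_weightGE (c : ℤ) (hQ : (m : ℕ∞) ≤ Q.order) :
    Q.subst (uvar R) ∈ weightGE R (gaussWeight n c) m := by
  rw [subst_uvar_eq_rename]
  refine rename_mem_weightGE fun d hd => ?_
  have hdeg : m ≤ d.degree := by exact_mod_cast hQ.trans (order_le hd)
  have hweight : Finsupp.weight (gaussWeight n c ∘ Sum.inr ∘ Sum.inl) d = d.degree := by
    simp [gaussWeight, Finsupp.weight_apply, Finsupp.sum_fintype, Finsupp.degree_eq_sum]
  rw [hweight]
  exact_mod_cast hdeg

theorem two_le_order_nonlinPart (F : Fin n → MvPowerSeries (Fin n) R) (i : Fin n) :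
    ((2 : ℕ) : ℕ∞) ≤ (nonlinPart F i).order :=
  nat_le_order fun _ hd => if_neg hd.not_ge

theorem interaction_mem_weightGE (F : Fin n → MvPowerSeries (Fin n) R) (hc : c ≤ 1) :
    interaction F ∈ weightGE R (gaussWeight n c) 0 := by
  refine add_mem (sum_mem fun i _ => ?_) (sum_mem fun i _ => ?_)
  · exact weightGE_antitone _ (by simp only [gaussWeight, Sum.elim_inl]; omega)
      (mul_mem_weightGE (X_mem_weightGE _ _)
        (subst_uvar_mem_weightGE c (two_le_order_nonlinPart F i)))
  · simpa [gaussWeight, ubar, yvar] using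
      mul_mem_weightGE (X_mem_weightGE (R := R) (gaussWeight n c) (Sum.inl i))
        (X_mem_weightGE _ (Sum.inr (Sum.inr i)))

theorem constantCoeff_interaction (F : Fin n → MvPowerSeries (Fin n) R) :
    constantCoeff (interaction F) = 0 := by
  simp [interaction, ubar]

theorem pderiv_ubar_subst_uvar (Q : MvPowerSeries (Fin n) R) (j : Fin n) :
    pderiv R (Sum.inl j) (Q.subst (uvar R : Fin n → MvPowerSeries (Vars n) R)) = 0 := by
  rw [subst_uvar_eq_rename, pderiv_rename_eq_zero (by simp)]

theorem pderiv_ubar_interaction (F : Fin n → MvPowerSeries (Fin n) R) (j : Fin n) :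
    pderiv R (Sum.inl j) (interaction F) = (nonlinPart F j).subst (uvar R) + yvar R j := by
  classical
  simp [interaction, Derivation.leibniz, pderiv_ubar_subst_uvar, ubar, yvar, pderiv_X,
    Pi.single_apply]

variable [Algebra ℚ R]

theorem expInteraction_mem_weightGE (F : Fin n → MvPowerSeries (Fin n) R) (hc : c ≤ 1) :
    expInteraction F ∈ weightGE R (gaussWeight n c) 0 :=
  powerSeries_subst_mem_weightGE_zero (interaction_mem_weightGE F hc)
    (constantCoeff_interaction F) _

theorem pderiv_ubar_expInteraction (F : Fin n → MvPowerSeries (Fin n) R) (j : Fin n) :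
    pderiv R (Sum.inl j) (expInteraction F) =
      ((nonlinPart F j).subst (uvar R) + yvar R j) * expInteraction F := by
  rw [expInteraction, pderiv_powerSeries_subst _ (constantCoeff_interaction F),
    PowerSeries.derivative_exp, pderiv_ubar_interaction, mul_comm]

theorem constantCoeff_expInteraction (F : Fin n → MvPowerSeries (Fin n) R) :
    constantCoeff (expInteraction F) = 1 := by
  rw [expInteraction, PowerSeries.constantCoeff_subst
    (.of_constantCoeff_zero (constantCoeff_interaction F)), finsum_eq_single _ 0]
  · simp
  · intro m hm
    simp [constantCoeff_interaction, hm]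

theorem constantCoeff_gaussIntegral_expInteraction (F : Fin n → MvPowerSeries (Fin n) R) :
    constantCoeff (gaussIntegral A (expInteraction F)) = Ring.inverse A.det := by
  rw [← coeff_zero_eq_constantCoeff_apply, coeff_gaussIntegral, finsum_eq_single _ 0]
  · have hzero : varsExponent (0 : Fin n →₀ ℕ) 0 0 = 0 := by
      ext (i | i | i) <;> simp [varsExponent]
    rw [gaussTerm_eq, Prod.fst_zero, Prod.snd_zero, hzero, coeff_zero_eq_constantCoeff_apply,
      constantCoeff_expInteraction, one_mul, gaussMonomial_zero_zero]
  · intro α hα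
    by_contra h
    obtain ⟨hdeg, hle⟩ := degree_of_gaussTerm_ne_zero (expInteraction_mem_weightGE F le_rfl) h
    simp only [map_zero] at hle
    exact hα (Prod.ext ((Finsupp.degree_eq_zero_iff _).1 (by omega))
      ((Finsupp.degree_eq_zero_iff _).1 (by omega)))

end GaussWeight

section Moment

variable {R : Type*} [CommRing R] {n : ℕ}

theorem hasSubst_uvar : HasSubst (uvar R : Fin n → MvPowerSeries (Vars n) R) :=
  hasSubst_of_constantCoeff_zero fun _ => constantCoeff_X _

variable [Algebra ℚ R] {F : Fin n → MvPowerSeries (Fin n) R} {c : ℤ} {m : ℕ}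
  {Q : MvPowerSeries (Fin n) R}

theorem subst_uvar_mul_expInteraction_mem_weightGE (hc : c ≤ 1) (hQ : (m : ℕ∞) ≤ Q.order) :
    Q.subst (uvar R) * expInteraction F ∈ weightGE R (gaussWeight n c) m := by
  simpa using mul_mem_weightGE (subst_uvar_mem_weightGE c hQ) (expInteraction_mem_weightGE F hc)

theorem gaussSummable_subst_uvar_mul_expInteraction (A : Matrix (Fin n) (Fin n) R)
    (F : Fin n → MvPowerSeries (Fin n) R) (Q : MvPowerSeries (Fin n) R) :
    GaussSummable A (Q.subst (uvar R) * expInteraction F) :=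
  gaussSummable_of_mem_weightGE
    (subst_uvar_mul_expInteraction_mem_weightGE (m := 0) le_rfl (by simp))

theorem uvar_mul_subst_uvar_mul_expInteraction (F : Fin n → MvPowerSeries (Fin n) R) (k : Fin n)
    (Q : MvPowerSeries (Fin n) R) :
    uvar R k * (Q.subst (uvar R) * expInteraction F) =
      (X k * Q).subst (uvar R) * expInteraction F := by
  rw [subst_mul hasSubst_uvar, subst_X hasSubst_uvar, mul_assoc]

/-- The unnormalised moment `⟨Q⟩ = ∫ dū du e^{-ūAu} Q(u) e^{ūH(u) + ūY}`, as a linear map in the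
power series `Q`. -/
noncomputable def gaussMoment (F : Fin n → MvPowerSeries (Fin n) R) :
    MvPowerSeries (Fin n) R →ₗ[R] MvPowerSeries (Fin n) R where
  toFun Q := gaussIntegral (linMatrix F) (Q.subst (uvar R) * expInteraction F)
  map_add' P Q := by
    rw [subst_add hasSubst_uvar, add_mul, gaussIntegral_add] <;>
      exact gaussSummable_subst_uvar_mul_expInteraction _ _ _
  map_smul' r Q := by
    rw [subst_smul hasSubst_uvar, smul_mul_assoc, gaussIntegral_smul, RingHom.id_apply]
    exact gaussSummable_subst_uvar_mul_expInteraction _ _ _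

theorem gaussMoment_apply (F : Fin n → MvPowerSeries (Fin n) R) (Q : MvPowerSeries (Fin n) R) :
    gaussMoment F Q = gaussIntegral (linMatrix F) (Q.subst (uvar R) * expInteraction F) :=
  rfl

theorem gaussMoment_one (F : Fin n → MvPowerSeries (Fin n) R) :
    gaussMoment F 1 = gaussIntegral (linMatrix F) (expInteraction F) := by
  rw [gaussMoment_apply, ← substAlgHom_apply hasSubst_uvar, map_one, one_mul]

theorem gaussMoment_X (F : Fin n → MvPowerSeries (Fin n) R) (i : Fin n) :
    gaussMoment F (X i) = gaussIntegral (linMatrix F) (uvar R i * expInteraction F) := by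
  rw [gaussMoment_apply, subst_X hasSubst_uvar]

theorem isUnit_gaussMoment_one (hA : IsUnit (linMatrix F)) : IsUnit (gaussMoment F 1) := by
  rw [gaussMoment_one, isUnit_iff_constantCoeff, constantCoeff_gaussIntegral_expInteraction]
  exact ((Matrix.isUnit_iff_isUnit_det _).1 hA).ringInverse

theorem order_le_order_gaussMoment (F : Fin n → MvPowerSeries (Fin n) R)
    (Q : MvPowerSeries (Fin n) R) : Q.order ≤ (gaussMoment F Q).order :=
  ENat.forall_natCast_le_iff_le.1 fun _ hm =>
    le_order_gaussIntegral (subst_uvar_mul_expInteraction_mem_weightGE zero_le_one hm)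

theorem pderiv_ubar_subst_uvar_mul_expInteraction (F : Fin n → MvPowerSeries (Fin n) R)
    (j : Fin n) (Q : MvPowerSeries (Fin n) R) :
    pderiv R (Sum.inl j) (Q.subst (uvar R) * expInteraction F) =
      (nonlinPart F j * Q).subst (uvar R) * expInteraction F +
        yvar R j * (Q.subst (uvar R) * expInteraction F) := by
  rw [Derivation.leibniz, pderiv_ubar_subst_uvar, pderiv_ubar_expInteraction,
    subst_mul hasSubst_uvar, smul_zero, smul_eq_mul]
  ring

theorem gaussMoment_linPart_mul (F : Fin n → MvPowerSeries (Fin n) R) (j : Fin n)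
    (Q : MvPowerSeries (Fin n) R) :
    gaussMoment F (linPart F j * Q) = ∑ k, linMatrix F j k • gaussIntegral (linMatrix F)
      (uvar R k * (Q.subst (uvar R) * expInteraction F)) := by
  simp only [linPart, Finset.sum_mul, map_sum, ← smul_eq_C_mul, smul_mul_assoc, map_smul,
    uvar_mul_subst_uvar_mul_expInteraction, gaussMoment_apply]

/-- Integration by parts in `ū_j`. -/
theorem gaussMoment_linPart_mul_eq (hA : IsUnit (linMatrix F)) (j : Fin n)
    (Q : MvPowerSeries (Fin n) R) :
    gaussMoment F (linPart F j * Q) =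
      gaussMoment F (nonlinPart F j * Q) + X j * gaussMoment F Q := by
  have hY : GaussSummable (linMatrix F) (yvar R j * (Q.subst (uvar R) * expInteraction F)) :=
    gaussSummable_of_mem_weightGE <| mul_mem_weightGE (X_mem_weightGE _ _)
      (subst_uvar_mul_expInteraction_mem_weightGE (m := 0) le_rfl (by simp))
  rw [gaussMoment_linPart_mul, ← gaussIntegral_pderiv hA,
    pderiv_ubar_subst_uvar_mul_expInteraction,
    gaussIntegral_add (gaussSummable_subst_uvar_mul_expInteraction _ _ _) hY,
    gaussIntegral_yvar_mul, gaussMoment_apply, gaussMoment_apply]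
  intro k
  rw [uvar_mul_subst_uvar_mul_expInteraction]
  exact gaussSummable_subst_uvar_mul_expInteraction _ _ _

theorem gaussMoment_mul_left (hF : ∀ i, constantCoeff (F i) = 0) (hA : IsUnit (linMatrix F))
    (j : Fin n) (Q : MvPowerSeries (Fin n) R) :
    gaussMoment F (F j * Q) = X j * gaussMoment F Q := by
  rw [eq_linPart_sub_nonlinPart F hF j, sub_mul, map_sub, gaussMoment_linPart_mul_eq hA,
    add_sub_cancel_left]

theorem gaussMoment_aeval (hF : ∀ i, constantCoeff (F i) = 0) (hA : IsUnit (linMatrix F))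
    (p : MvPolynomial (Fin n) R) :
    gaussMoment F (MvPolynomial.aeval F p) = p * gaussMoment F 1 := by
  induction p using MvPolynomial.induction_on with
  | C a => rw [MvPolynomial.aeval_C, Algebra.algebraMap_eq_smul_one, map_smul,
      MvPolynomial.coe_C, smul_eq_C_mul]
  | add p q hp hq => rw [map_add, map_add, hp, hq, MvPolynomial.coe_add, add_mul]
  | mul_X p i hp =>
    rw [map_mul, MvPolynomial.aeval_X, mul_comm, gaussMoment_mul_left hF hA, hp,
      MvPolynomial.coe_mul, MvPolynomial.coe_X, mul_left_comm, mul_assoc]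

theorem gaussMoment_subst (hF : ∀ i, constantCoeff (F i) = 0) (hA : IsUnit (linMatrix F))
    (Q : MvPowerSeries (Fin n) R) : gaussMoment F (Q.subst F) = Q * gaussMoment F 1 := by
  have hs := hasSubst_of_constantCoeff_zero hF
  have hcomp : gaussMoment F ∘ₗ (substAlgHom hs).toLinearMap =
      LinearMap.mulRight R (gaussMoment F 1) := by
    refine linearMap_eq_of_eq_on_mvPolynomial (fun P => ?_) (fun P => ?_) fun p => ?_
    · rw [LinearMap.comp_apply, AlgHom.toLinearMap_apply, substAlgHom_apply]
      exact (order_le_order_subst hF P).trans (order_le_order_gaussMoment F _)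
    · exact le_self_add.trans le_order_mul
    · rw [LinearMap.comp_apply, AlgHom.toLinearMap_apply, substAlgHom_apply, subst_coe,
        gaussMoment_aeval hF hA, LinearMap.mulRight_apply]
  simpa only [LinearMap.comp_apply, AlgHom.toLinearMap_apply, substAlgHom_apply,
    LinearMap.mulRight_apply] using LinearMap.congr_fun hcomp Q

end Moment

section Expectation

variable {R : Type*} [CommRing R] [Algebra ℚ R] {n : ℕ} {F : Fin n → MvPowerSeries (Fin n) R}

/-- The normalised moment `⟨Q⟩ / ⟨1⟩`, which turns out to be `Q ∘ F⁻¹`. -/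
noncomputable def gaussExpectation (F : Fin n → MvPowerSeries (Fin n) R) :
    MvPowerSeries (Fin n) R →ₗ[R] MvPowerSeries (Fin n) R :=
  LinearMap.mulRight R (Ring.inverse (gaussMoment F 1)) ∘ₗ gaussMoment F

theorem gaussExpectation_apply (F : Fin n → MvPowerSeries (Fin n) R)
    (Q : MvPowerSeries (Fin n) R) :
    gaussExpectation F Q = gaussMoment F Q * Ring.inverse (gaussMoment F 1) :=
  rfl

theorem order_le_order_gaussExpectation (F : Fin n → MvPowerSeries (Fin n) R)
    (Q : MvPowerSeries (Fin n) R) : Q.order ≤ (gaussExpectation F Q).order :=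
  (order_le_order_gaussMoment F Q).trans (le_self_add.trans le_order_mul)

theorem constantCoeff_gaussExpectation_X (F : Fin n → MvPowerSeries (Fin n) R) (i : Fin n) :
    constantCoeff (gaussExpectation F (X i)) = 0 :=
  one_le_order_iff_constCoeff_eq_zero.1 <|
    (one_le_order_iff_constCoeff_eq_zero.2 (constantCoeff_X i)).trans
      (order_le_order_gaussExpectation F _)

theorem gaussExpectation_subst (hF : ∀ i, constantCoeff (F i) = 0) (hA : IsUnit (linMatrix F))
    (Q : MvPowerSeries (Fin n) R) : gaussExpectation F (Q.subst F) = Q := by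
  rw [gaussExpectation_apply, gaussMoment_subst hF hA, mul_assoc,
    Ring.mul_inverse_cancel _ (isUnit_gaussMoment_one hA), mul_one]

theorem subst_gaussExpectation (hF : ∀ i, constantCoeff (F i) = 0) (hA : IsUnit (linMatrix F))
    (Q : MvPowerSeries (Fin n) R) : (gaussExpectation F Q).subst F = Q := by
  have hsurj : Function.Surjective (gaussExpectation F) := fun P =>
    ⟨P.subst F, gaussExpectation_subst hF hA P⟩
  exact injective_of_surjective_of_le_order (order_le_order_gaussExpectation F) hsurj
    (gaussExpectation_subst hF hA _)

theorem isCompInverse_gaussExpectation_X (hF : ∀ i, constantCoeff (F i) = 0)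
    (hA : IsUnit (linMatrix F)) : IsCompInverse F fun i => gaussExpectation F (X i) where
  constantCoeff_left := hF
  constantCoeff_right := constantCoeff_gaussExpectation_X F
  comp_right i := subst_gaussExpectation hF hA (X i)
  comp_left i := by
    have hinj : Function.Injective (subst F : MvPowerSeries (Fin n) R → MvPowerSeries (Fin n) R) :=
      Function.LeftInverse.injective (gaussExpectation_subst hF hA)
    apply hinj
    rw [subst_comp_subst_apply (hasSubst_of_constantCoeff_zero (constantCoeff_gaussExpectation_X F))
      (hasSubst_of_constantCoeff_zero hF), subst_X (hasSubst_of_constantCoeff_zero hF)]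
    simp only [subst_gaussExpectation hF hA, subst_self, id]

theorem IsCompInverse.eq_gaussExpectation_X {G : Fin n → MvPowerSeries (Fin n) R}
    (hG : IsCompInverse F G) (hA : IsUnit (linMatrix F)) (i : Fin n) :
    G i = gaussExpectation F (X i) := by
  rw [← hG.comp_right i, gaussExpectation_subst hG.constantCoeff_left hA]

end Expectation

end FormalGauss

open FormalGauss

theorem theorem5 {R : Type*} [CommRing R] [Algebra ℚ R] (n : ℕ)
    (F : Fin n → MvPowerSeries (Fin n) R)
    (hF : ∀ i, MvPowerSeries.constantCoeff (F i) = 0)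
    (hA : IsUnit (FormalGauss.linMatrix F)) :
    (∀ i, FormalGauss.GaussSummable (FormalGauss.linMatrix F)
      (FormalGauss.uvar R i * FormalGauss.expInteraction F)) ∧
    FormalGauss.GaussSummable (FormalGauss.linMatrix F) (FormalGauss.expInteraction F) ∧
    IsUnit (FormalGauss.gaussIntegral (FormalGauss.linMatrix F)
      (FormalGauss.expInteraction F)) ∧
    ∃ G : Fin n → MvPowerSeries (Fin n) R,
      FormalGauss.IsCompInverse F G ∧
      (∀ G', FormalGauss.IsCompInverse F G' → G' = G) ∧
      ∀ i, G i =
        FormalGauss.gaussIntegral (FormalGauss.linMatrix F)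
            (FormalGauss.uvar R i * FormalGauss.expInteraction F) *
          Ring.inverse (FormalGauss.gaussIntegral (FormalGauss.linMatrix F)
            (FormalGauss.expInteraction F)) := by
  refine ⟨fun i => ?_, ?_, ?_, fun i => gaussExpectation F (MvPowerSeries.X i),
    isCompInverse_gaussExpectation_X hF hA,
    fun G' hG' => funext (hG'.eq_gaussExpectation_X hA), fun i => ?_⟩
  · simpa only [MvPowerSeries.subst_X hasSubst_uvar] using
      gaussSummable_subst_uvar_mul_expInteraction (linMatrix F) F (MvPowerSeries.X i)
  · exact gaussSummable_of_mem_weightGE (expInteraction_mem_weightGE F le_rfl)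
  · exact gaussMoment_one F ▸ isUnit_gaussMoment_one hA
  · simp only [gaussExpectation_apply, gaussMoment_X, gaussMoment_one]
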